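/- Proposition 1. Work in bipartite EPR scenarios with a finite-dimensional system for Bob. An assemblage $\boldsymbol\Sigma=\{\{\sigma_{a|x}\}_{a}\}_{x}$ (finite sets of outcomes $a$ and of settings $x$, with at least one setting) is a family of operators of the form $\sigma_{a|x}=\mathrm{tr}_A[(M_{a|x}\otimes\mathbb I)\rho]$, with $\rho$ a density operator on $\mathcal H_A\otimes\mathcal H_B$ and $\{M_{a|x}\}_a$ a POVM on $\mathcal H_A$ for each $x$. In both classes of operations below, Alice's local classical processing is a conditional distribution $p(a',x|x',a,\cdot)$ whose marginal on $x$ does not depend on $a$. * $\boldsymbol\Sigma$ is convertible to $\boldsymbol\Sigma'$ under LOSR if $\sigma'_{a'|x'}=\sum_\lambda p(\lambda)\sum_{a,x}p(a',x|x',a,\lambda)\,\mathcal E_\lambda(\sigma_{a|x})$ for a finitely valued shared random variable $\lambda$ with distribution $p(\lambda)$, local processings $p(a',x|x',a,\lambda)$ of Alice, and CPTP maps $\mathcal E_\lambda$ of Bob. * $\boldsymbol\Sigma$ is convertible to $\boldsymbol\Sigma'$ under S-1W-LOCC with success probability $P>0$ if $P\,\sigma'_{a'|x'}=\sum_\omega\sum_{a,x}p(a',x|x',a,\omega)\,\mathcal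 E_\omega(\sigma_{a|x})$ for finitely many completely positive maps $\mathcal E_\omega$ of Bob whose sum is trace non-increasing, and local processings $p(a',x|x',a,\omega)$ of Alice. It is convertible under deterministic 1W-LOCC if one can take $\sum_\omega\mathcal E_\omega$ trace preserving and $P=1$. Each of these three convertibility relations is a pre-order on assemblages. For $\theta\in(0,\pi/4]$ and $p\in[0,1]$ let $\boldsymbol\Sigma^{\theta,p}$ be the assemblage with elements $p\,\sigma^\theta_{a|x}+(1-p)\,\mathbb I/4$, $a,x\in\{0,1\}$, where $\sigma^\theta_{a|x}=\mathrm{tr}_A[(\widetilde M_{a|x}\otimes\mathbb I)|\theta\rangle\langle\theta|]$, $|\theta\rangle=\cos\theta|00\rangle+\sin\theta|11\rangle$, $\widetilde M_{a|0}=(\mathbb I+(-1)^a\sigma_z)/2$, $\widetilde M_{a|1}=(\mathbb I+(-1)^a\sigma_x)/2$. Then: 1. The pre-order of assemblages under LOSR is different from the pre-order under S-1W-LOCC, and also from the pre-order under deterministic 1W-LOCC. 2. For every $\theta\in(0,\pi/4]$, the S-1W-LOCC operation whose instrument has the single map $M_0\cdot M_0^\dagger$, $M_0=\cos\theta|0\rangle\langle0|+\sin\theta|1\rangle\langle1|$,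 with no action by Alice, converts $\boldsymbol\Sigma^{\pi/4,1}$ to $\boldsymbol\Sigma^{\theta,1}$ with success probability $1/2$. 3. For every $\theta\in(0,\pi/4]$, the 1W-LOCC operation with the instrument $\{M_\omega\cdot M_\omega^\dagger\}_{\omega\in\{0,1\}}$, $M_1=\sin\theta|1\rangle\langle0|+\cos\theta|0\rangle\langle1|$, in which Alice measures $x=x'$ and outputs $a'=a\oplus x\omega\oplus\omega$, is deterministic and converts $\boldsymbol\Sigma^{\pi/4,1}$ to $\boldsymbol\Sigma^{\theta,1}$. 4. Under S-1W-LOCC, and also under deterministic 1W-LOCC, $\boldsymbol\Sigma^{\pi/4,1}$ is convertible to $\boldsymbol\Sigma^{\theta,p}$ for all $\theta\in(0,\pi/4]$ and $p\in[0,1]$. 5. Under LOSR, the assemblages $\boldsymbol\Sigma^{\theta,1}$, $\theta\in(0,\pi/4]$, are pairwise incomparable: if $\theta_1\ne\theta_2$, neither of $\boldsymbol\Sigma^{\theta_1,1}$, $\boldsymbol\Sigma^{\theta_2,1}$ is convertible to the other. -/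

import Mathlib

open scoped Matrix Kronecker ComplexOrder
open Matrix Real

/-- Complex square matrices: the operators on a `d`-dimensional quantum system. -/
abbrev Op (d : ℕ) : Type := Matrix (Fin d) (Fin d) ℂ

/-! ### Quantum channels on finite-dimensional systems -/

/-- Complete positivity: for every `k`, the map `Φ ⊗ id_k` sends positive semidefinite matrices
to positive semidefinite matrices. -/
def IsCompletelyPositive {d e : ℕ} (Φ : Op d →ₗ[ℂ] Op e) : Prop :=
  ∀ (k : ℕ) (M : Matrix (Fin d × Fin k) (Fin d × Fin k) ℂ), M.PosSemidef →
    (Matrix.of fun r s : Fin e × Fin k =>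
      Φ (Matrix.of fun i j => M (i, r.2) (j, s.2)) r.1 s.1).PosSemidef

/-- Trace preservation. -/
def IsTracePreserving {d e : ℕ} (Φ : Op d →ₗ[ℂ] Op e) : Prop :=
  ∀ ρ : Op d, (Φ ρ).trace = ρ.trace

/-- The map `ρ ↦ K ρ K†` with a single Kraus operator `K`. -/
def krausMap {d e : ℕ} (K : Matrix (Fin e) (Fin d) ℂ) : Op d →ₗ[ℂ] Op e where
  toFun ρ := K * ρ * Kᴴ
  map_add' ρ τ := by rw [Matrix.mul_add, Matrix.add_mul]
  map_smul' c ρ := by simp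

theorem isCompletelyPositive_id (d : ℕ) :
    IsCompletelyPositive (LinearMap.id : Op d →ₗ[ℂ] Op d) := fun _ _ hM => hM

theorem IsCompletelyPositive.comp {d e f : ℕ} {Ψ : Op e →ₗ[ℂ] Op f} {Φ : Op d →ₗ[ℂ] Op e}
    (hΨ : IsCompletelyPositive Ψ) (hΦ : IsCompletelyPositive Φ) :
    IsCompletelyPositive (Ψ ∘ₗ Φ) := fun k _ hM => hΨ k _ (hΦ k _ hM)

theorem IsCompletelyPositive.posSemidef {d e : ℕ} {Φ : Op d →ₗ[ℂ] Op e}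
    (hΦ : IsCompletelyPositive Φ) {ρ : Op d} (hρ : ρ.PosSemidef) : (Φ ρ).PosSemidef := by
  have h := hΦ 1 (ρ.submatrix Prod.fst Prod.fst) (hρ.submatrix Prod.fst)
  exact h.submatrix (fun i : Fin e => (i, (0 : Fin 1)))

theorem isCompletelyPositive_krausMap {d e : ℕ} (K : Matrix (Fin e) (Fin d) ℂ) :
    IsCompletelyPositive (krausMap K) := by
  intro k M hM
  have h := hM.mul_mul_conjTranspose_same (K ⊗ₖ (1 : Matrix (Fin k) (Fin k) ℂ))
  convert h using 1
  ext ⟨i, r⟩ ⟨j, s⟩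
  simp [krausMap, Matrix.mul_apply, Fintype.sum_prod_type, Matrix.one_apply,
    Matrix.conjTranspose_apply, apply_ite]

/-! ### Assemblages -/

/-- Partial trace over the first (Alice's) tensor factor. -/
def ptraceA {m d : ℕ} (ρ : Matrix (Fin m × Fin d) (Fin m × Fin d) ℂ) : Op d :=
  Matrix.of fun i j => ∑ k, ρ (k, i) (k, j)

/-- `σ_{a|x} = tr_A[(M_{a|x} ⊗ 1) ρ]` for a state `ρ` shared by Alice and Bob and POVMs
`{M_{a|x}}_a` on Alice's system. -/
def IsQuantumRealization {nA nX m d : ℕ}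
    (ρ : Matrix (Fin m × Fin d) (Fin m × Fin d) ℂ) (M : Fin nA → Fin nX → Op m)
    (σ : Fin nA → Fin nX → Op d) : Prop :=
  ρ.PosSemidef ∧ ρ.trace = 1 ∧
  (∀ a x, (M a x).PosSemidef) ∧ (∀ x, ∑ a, M a x = 1) ∧
  ∀ a x, σ a x = ptraceA ((M a x ⊗ₖ (1 : Op d)) * ρ)

/-- A (quantumly realizable) bipartite assemblage with `nX` measurement settings and `nA`
outcomes for Alice, and a `d`-dimensional quantum system for Bob. `σ a x` is the unnormalised
state `σ_{a|x} = p(a|x) ρ_{a|x}`. -/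
structure Assemblage (nA nX d : ℕ) where
  σ : Fin nA → Fin nX → Op d
  realizable : ∃ (m : ℕ) (ρ : Matrix (Fin m × Fin d) (Fin m × Fin d) ℂ)
    (M : Fin nA → Fin nX → Op m), IsQuantumRealization ρ M σ

/-- The resources: assemblages with any numbers of settings and outcomes and any dimension of
Bob's system. -/
structure Resource where
  nA : ℕ
  nX : ℕ
  d : ℕ
  nX_pos : 0 < nX
  asm : Assemblage nA nX d

/-! ### Local processing -/

/-- Alice's local classical processing `p(a', x | x', a)`: she chooses the input `x` knowing
`x'`, then the output `a'` knowing `x'`, `x` and `a`. The marginal distribution `inp x x'` of `x`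
depends on `x'` only and not on the later variable `a` (no retrocausation); equivalently,
`p(a', x | x', a) = p(x | x') p(a' | a, x, x')`. -/
structure Comb (nA nX nA' nX' : ℕ) where
  prob : Fin nA' → Fin nX → Fin nX' → Fin nA → ℝ
  inp : Fin nX → Fin nX' → ℝ
  nonneg : ∀ a' x x' a, 0 ≤ prob a' x x' a
  inp_nonneg : ∀ x x', 0 ≤ inp x x'
  sum_inp : ∀ x', ∑ x, inp x x' = 1
  no_retro : ∀ x x' a, ∑ a', prob a' x x' a = inp x x'

/-- The deterministic processing `x = g x'`, `a' = f a x'`. -/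
def Comb.ofFun {nA nX nA' nX' : ℕ} (g : Fin nX' → Fin nX) (f : Fin nA → Fin nX' → Fin nA') :
    Comb nA nX nA' nX' where
  prob a' x x' a := if a' = f a x' then (if x = g x' then 1 else 0) else 0
  inp x x' := if x = g x' then 1 else 0
  nonneg a' x x' a := by split_ifs <;> norm_num
  inp_nonneg x x' := by split_ifs <;> norm_num
  sum_inp x' := by simp
  no_retro x x' a := by simp

/-- Sequential composition: `C` is applied first, `D` to its result. -/
def Comb.comp {nA nX nA' nX' nA'' nX'' : ℕ} (D : Comb nA' nX' nA'' nX'')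
    (C : Comb nA nX nA' nX') : Comb nA nX nA'' nX'' where
  prob a'' x x'' a := ∑ a', ∑ x', D.prob a'' x' x'' a' * C.prob a' x x' a
  inp x x'' := ∑ x', D.inp x' x'' * C.inp x x'
  nonneg a'' x x'' a := Finset.sum_nonneg fun a' _ => Finset.sum_nonneg fun x' _ =>
    mul_nonneg (D.nonneg ..) (C.nonneg ..)
  inp_nonneg x x'' := Finset.sum_nonneg fun x' _ => mul_nonneg (D.inp_nonneg ..) (C.inp_nonneg ..)
  sum_inp x'' := by
    rw [Finset.sum_comm]
    simp_rw [← Finset.mul_sum, C.sum_inp, mul_one, D.sum_inp]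
  no_retro x x'' a := by
    rw [Finset.sum_comm]
    simp_rw [Finset.sum_comm (s := (Finset.univ : Finset (Fin nA''))), ← Finset.sum_mul,
      D.no_retro]
    rw [Finset.sum_comm]
    simp_rw [← Finset.mul_sum, C.no_retro]

/-- One branch of a transformation: Alice processes her classical variables with `C`, and Bob
applies `Φ`. The result is
`σ'_{a'|x'} = ∑_{a,x} p(a', x | x', a) Φ(σ_{a|x})`. -/
def branch {nA nX d nA' nX' d' : ℕ} (C : Comb nA nX nA' nX') (Φ : Op d →ₗ[ℂ] Op d')
    (σ : Fin nA → Fin nX → Op d) (a' : Fin nA') (x' : Fin nX') : Op d' :=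
  ∑ a, ∑ x, ((C.prob a' x x' a : ℝ) : ℂ) • Φ (σ a x)

theorem branch_id {nA nX d : ℕ} (σ : Fin nA → Fin nX → Op d) (a : Fin nA) (x : Fin nX) :
    branch (Comb.ofFun id fun a _ => a) LinearMap.id σ a x = σ a x := by
  simp only [branch, Comb.ofFun, LinearMap.id_coe, id]
  rw [Finset.sum_eq_single a (by intro b _ hb; simp [Ne.symm hb]) (by simp),
    Finset.sum_eq_single x (by intro b _ hb; simp [hb]) (by simp)]
  simp

theorem branch_comp {nA nX d nA' nX' d' nA'' nX'' d'' : ℕ}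
    (D : Comb nA' nX' nA'' nX'') (C : Comb nA nX nA' nX')
    (Ψ : Op d' →ₗ[ℂ] Op d'') (Φ : Op d →ₗ[ℂ] Op d') (σ : Fin nA → Fin nX → Op d)
    (a'' : Fin nA'') (x'' : Fin nX'') :
    branch D Ψ (branch C Φ σ) a'' x'' = branch (D.comp C) (Ψ ∘ₗ Φ) σ a'' x'' := by
  simp only [branch, Comb.comp, map_sum, map_smul, LinearMap.comp_apply, Finset.smul_sum,
    smul_smul, Complex.ofReal_sum, Complex.ofReal_mul, Finset.sum_smul]
  calc _ = ∑ a', ∑ a, ∑ x', ∑ x, _ := Finset.sum_congr rfl fun a' _ => Finset.sum_comm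
    _ = ∑ a, ∑ a', ∑ x', ∑ x, _ := Finset.sum_comm
    _ = ∑ a, ∑ a', ∑ x, ∑ x', _ :=
      Finset.sum_congr rfl fun a _ => Finset.sum_congr rfl fun a' _ => Finset.sum_comm
    _ = _ := Finset.sum_congr rfl fun a _ => Finset.sum_comm

theorem branch_sum_smul {nA nX d nA' nX' d' : ℕ} {ι : Type} [Fintype ι]
    (C : Comb nA nX nA' nX') (Φ : Op d →ₗ[ℂ] Op d') (c : ι → ℂ)
    (σ : ι → Fin nA → Fin nX → Op d) (a' : Fin nA') (x' : Fin nX') :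
    branch C Φ (fun a x => ∑ i, c i • σ i a x) a' x' = ∑ i, c i • branch C Φ (σ i) a' x' := by
  simp only [branch, map_sum, map_smul, Finset.smul_sum]
  calc _ = ∑ a, ∑ i, ∑ x, _ := Finset.sum_congr rfl fun a _ => Finset.sum_comm
    _ = ∑ i, ∑ a, ∑ x, _ := Finset.sum_comm
    _ = _ := Finset.sum_congr rfl fun i _ => Finset.sum_congr rfl fun a _ =>
      Finset.sum_congr rfl fun x _ => smul_comm _ _ _

/-! ### LOSR operations -/

/-- An LOSR operation: a shared classical random variable `l` with distribution `p`; given `l`,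
Alice applies the classical processing `alice l` and Bob the CPTP map `bob l`. -/
structure LOSROp (nA nX d nA' nX' d' : ℕ) where
  L : Type
  [fintypeL : Fintype L]
  p : L → ℝ
  p_nonneg : ∀ l, 0 ≤ p l
  sum_p : ∑ l, p l = 1
  alice : L → Comb nA nX nA' nX'
  bob : L → (Op d →ₗ[ℂ] Op d')
  bob_cp : ∀ l, IsCompletelyPositive (bob l)
  bob_tp : ∀ l, IsTracePreserving (bob l)

attribute [instance] LOSROp.fintypeL

/-- The action of an LOSR operation,
`σ'_{a'|x'} = ∑_l p(l) ∑_{a,x} p(a', x | x', a, l) bob_l(σ_{a|x})`. -/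
def LOSROp.apply {nA nX d nA' nX' d' : ℕ} (T : LOSROp nA nX d nA' nX' d')
    (σ : Fin nA → Fin nX → Op d) (a' : Fin nA') (x' : Fin nX') : Op d' :=
  ∑ l, ((T.p l : ℝ) : ℂ) • branch (T.alice l) (T.bob l) σ a' x'

/-- `R` can be converted into `S` by an LOSR operation. -/
def LOSRConvertible (R S : Resource) : Prop :=
  ∃ T : LOSROp R.nA R.nX R.d S.nA S.nX S.d, ∀ a' x', T.apply R.asm.σ a' x' = S.asm.σ a' x'

theorem LOSRConvertible.refl (R : Resource) : LOSRConvertible R R :=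
  ⟨{ L := Unit
     p := fun _ => 1
     p_nonneg := fun _ => zero_le_one
     sum_p := by simp
     alice := fun _ => Comb.ofFun id fun a _ => a
     bob := fun _ => LinearMap.id
     bob_cp := fun _ => isCompletelyPositive_id _
     bob_tp := fun _ _ => rfl }, fun a x => by simp [LOSROp.apply, branch_id]⟩

theorem LOSRConvertible.trans {R S T : Resource} (h₁ : LOSRConvertible R S)
    (h₂ : LOSRConvertible S T) : LOSRConvertible R T := by
  obtain ⟨U, hU⟩ := h₁
  obtain ⟨V, hV⟩ := h₂
  refine ⟨{ L := V.L × U.L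
            p := fun l => V.p l.1 * U.p l.2
            p_nonneg := fun l => mul_nonneg (V.p_nonneg _) (U.p_nonneg _)
            sum_p := by
              rw [Fintype.sum_prod_type]
              simp_rw [← Finset.mul_sum, U.sum_p, mul_one, V.sum_p]
            alice := fun l => (V.alice l.1).comp (U.alice l.2)
            bob := fun l => V.bob l.1 ∘ₗ U.bob l.2
            bob_cp := fun l => (V.bob_cp _).comp (U.bob_cp _)
            bob_tp := fun l ρ => (V.bob_tp _ _).trans (U.bob_tp _ _) }, fun a'' x'' => ?_⟩
  have hS : S.asm.σ = fun a x => ∑ l, ((U.p l : ℝ) : ℂ) •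
      branch (U.alice l) (U.bob l) R.asm.σ a x := by
    funext a x
    exact (hU a x).symm
  rw [← hV a'' x'']
  simp only [LOSROp.apply]
  rw [hS, Fintype.sum_prod_type]
  refine Finset.sum_congr rfl fun l _ => ?_
  rw [branch_sum_smul, Finset.smul_sum]
  refine Finset.sum_congr rfl fun m _ => ?_
  rw [branch_comp, smul_smul, Complex.ofReal_mul]

/-- The pre-order of assemblages under LOSR: `R ≤ S` if `S` can be converted into `R`. -/
abbrev losrPreorder : Preorder Resource where
  le R S := LOSRConvertible S R
  le_refl := LOSRConvertible.refl
  le_trans _ _ _ h₁ h₂ := h₂.trans h₁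

/-! ### Stochastic local operations assisted by one-way classical communication -/

/-- An S-1W-LOCC operation: Bob applies an instrument `{bob w}_w`, i.e. completely positive maps
whose sum is trace non-increasing, and sends the outcome `w` to Alice, who applies the classical
processing `alice w`. -/
structure OneWayLOCC (nA nX d nA' nX' d' : ℕ) where
  W : Type
  [fintypeW : Fintype W]
  bob : W → (Op d →ₗ[ℂ] Op d')
  bob_cp : ∀ w, IsCompletelyPositive (bob w)
  bob_tni : ∀ ρ : Op d, ρ.PosSemidef → (∑ w, (bob w ρ).trace).re ≤ ρ.trace.re
  alice : W → Comb nA nX nA' nX'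

attribute [instance] OneWayLOCC.fintypeW

/-- The operation is a (deterministic) 1W-LOCC operation: Bob's instrument is complete. -/
def OneWayLOCC.IsDeterministic {nA nX d nA' nX' d' : ℕ} (T : OneWayLOCC nA nX d nA' nX' d') :
    Prop :=
  ∀ ρ : Op d, ∑ w, (T.bob w ρ).trace = ρ.trace

/-- The unnormalised result of the operation,
`∑_w ∑_{a,x} p(a', x | x', a, w) bob_w(σ_{a|x})`. -/
def OneWayLOCC.apply {nA nX d nA' nX' d' : ℕ} (T : OneWayLOCC nA nX d nA' nX' d')
    (σ : Fin nA → Fin nX → Op d) (a' : Fin nA') (x' : Fin nX') : Op d' :=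
  ∑ w, branch (T.alice w) (T.bob w) σ a' x'

/-- The operation succeeds with probability `P > 0` on the assemblage `Σ`, and the (normalised)
result is the assemblage `Σ'`. -/
def OneWayLOCC.Converts {nA nX d nA' nX' d' : ℕ} (T : OneWayLOCC nA nX d nA' nX' d') (P : ℝ)
    (S : Assemblage nA nX d) (S' : Assemblage nA' nX' d') : Prop :=
  0 < P ∧ ∀ a' x', T.apply S.σ a' x' = (P : ℂ) • S'.σ a' x'

/-- `R` can be converted into `S` by an S-1W-LOCC operation, with non-zero probability. -/
def S1WConvertible (R S : Resource) : Prop :=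
  ∃ (T : OneWayLOCC R.nA R.nX R.d S.nA S.nX S.d) (P : ℝ), T.Converts P R.asm S.asm

/-- `R` can be converted into `S` by a deterministic 1W-LOCC operation. -/
def Det1WConvertible (R S : Resource) : Prop :=
  ∃ T : OneWayLOCC R.nA R.nX R.d S.nA S.nX S.d, T.IsDeterministic ∧ T.Converts 1 R.asm S.asm

/-- The identity operation. -/
def OneWayLOCC.id (nA nX d : ℕ) : OneWayLOCC nA nX d nA nX d where
  W := Unit
  bob _ := LinearMap.id
  bob_cp _ := isCompletelyPositive_id _
  bob_tni ρ _ := by simp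
  alice _ := Comb.ofFun _root_.id fun a _ => a

theorem OneWayLOCC.id_isDeterministic (nA nX d : ℕ) :
    (OneWayLOCC.id nA nX d).IsDeterministic := fun ρ =>
  show ∑ _w : Unit, ρ.trace = ρ.trace by simp

theorem OneWayLOCC.id_converts {nA nX d : ℕ} (S : Assemblage nA nX d) :
    (OneWayLOCC.id nA nX d).Converts 1 S S := by
  refine ⟨one_pos, fun a x => ?_⟩
  change ∑ _w : Unit, branch (Comb.ofFun _root_.id fun a _ => a) LinearMap.id S.σ a x = _
  simp [branch_id]

/-- Sequential composition: `U` is applied first, `V` to its result. -/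
def OneWayLOCC.comp {nA nX d nA' nX' d' nA'' nX'' d'' : ℕ}
    (V : OneWayLOCC nA' nX' d' nA'' nX'' d'') (U : OneWayLOCC nA nX d nA' nX' d') :
    OneWayLOCC nA nX d nA'' nX'' d'' where
  W := V.W × U.W
  bob w := V.bob w.1 ∘ₗ U.bob w.2
  bob_cp w := (V.bob_cp _).comp (U.bob_cp _)
  bob_tni ρ hρ := by
    refine le_trans ?_ (U.bob_tni ρ hρ)
    rw [Fintype.sum_prod_type, Finset.sum_comm, Complex.re_sum, Complex.re_sum]
    exact Finset.sum_le_sum fun w _ => V.bob_tni _ ((U.bob_cp w).posSemidef hρ)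
  alice w := (V.alice w.1).comp (U.alice w.2)

theorem OneWayLOCC.IsDeterministic.comp {nA nX d nA' nX' d' nA'' nX'' d'' : ℕ}
    {V : OneWayLOCC nA' nX' d' nA'' nX'' d''} {U : OneWayLOCC nA nX d nA' nX' d'}
    (hV : V.IsDeterministic) (hU : U.IsDeterministic) : (V.comp U).IsDeterministic := by
  intro ρ
  have h : ∑ w : V.W × U.W, (V.bob w.1 (U.bob w.2 ρ)).trace = ρ.trace := by
    rw [Fintype.sum_prod_type, Finset.sum_comm]
    exact (Finset.sum_congr rfl fun w _ => hV (U.bob w ρ)).trans (hU ρ)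
  exact h

theorem OneWayLOCC.Converts.comp {nA nX d nA' nX' d' nA'' nX'' d'' : ℕ}
    {V : OneWayLOCC nA' nX' d' nA'' nX'' d''} {U : OneWayLOCC nA nX d nA' nX' d'} {P Q : ℝ}
    {S : Assemblage nA nX d} {S' : Assemblage nA' nX' d'} {S'' : Assemblage nA'' nX'' d''}
    (hV : V.Converts Q S' S'') (hU : U.Converts P S S') :
    (V.comp U).Converts (P * Q) S S'' := by
  refine ⟨mul_pos hU.1 hV.1, fun a'' x'' => ?_⟩
  have hP : (P : ℂ) ≠ 0 := Complex.ofReal_ne_zero.mpr hU.1.ne'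
  have hS : S'.σ = fun a x => ∑ w, (P : ℂ)⁻¹ • branch (U.alice w) (U.bob w) S.σ a x := by
    funext a x
    rw [← Finset.smul_sum]
    exact (inv_smul_smul₀ hP (S'.σ a x)).symm.trans (congrArg _ (hU.2 a x).symm)
  rw [Complex.ofReal_mul, mul_smul, ← hV.2 a'' x'']
  change ∑ w : V.W × U.W, branch ((V.alice w.1).comp (U.alice w.2))
    (V.bob w.1 ∘ₗ U.bob w.2) S.σ a'' x'' = _
  simp only [OneWayLOCC.apply]
  rw [hS, Fintype.sum_prod_type, Finset.smul_sum]
  refine Finset.sum_congr rfl fun w _ => ?_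
  rw [branch_sum_smul, Finset.smul_sum]
  refine Finset.sum_congr rfl fun v _ => ?_
  rw [branch_comp, smul_inv_smul₀ hP]

/-- The pre-order of assemblages under S-1W-LOCC: `R ≤ S` if `S` can be converted into `R`. -/
abbrev s1wPreorder : Preorder Resource where
  le R S := S1WConvertible S R
  le_refl _ := ⟨_, _, OneWayLOCC.id_converts _⟩
  le_trans := by
    rintro _ _ _ ⟨V, _, hV⟩ ⟨U, _, hU⟩
    exact ⟨_, _, hV.comp hU⟩

/-- The pre-order of assemblages under deterministic 1W-LOCC: `R ≤ S` if `S` can be converted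
into `R`. -/
abbrev det1wPreorder : Preorder Resource where
  le R S := Det1WConvertible S R
  le_refl _ := ⟨_, OneWayLOCC.id_isDeterministic _ _ _, OneWayLOCC.id_converts _⟩
  le_trans := by
    rintro _ _ _ ⟨V, hVd, hV⟩ ⟨U, hUd, hU⟩
    exact ⟨_, hVd.comp hUd, by simpa using hV.comp hU⟩

/-! ### The family `Σ^{θ,p}` -/

/-- The Pauli matrices `σ_z` (setting `0`) and `σ_x` (setting `1`). -/
def pauliZX (x : Fin 2) : Op 2 := if x = 0 then !![1, 0; 0, -1] else !![0, 1; 1, 0]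

/-- Alice's projective measurements `(1 + (-1)^a σ_z)/2` and `(1 + (-1)^a σ_x)/2`. -/
noncomputable def aliceMeas (a x : Fin 2) : Op 2 :=
  (2⁻¹ : ℂ) • (1 + (-1 : ℂ) ^ (a : ℕ) • pauliZX x)

/-- The two-qubit vector `cos θ |00⟩ + sin θ |11⟩`. -/
noncomputable def ketTheta (θ : ℝ) (i : Fin 2 × Fin 2) : ℂ :=
  if i = (0, 0) then (cos θ : ℂ) else if i = (1, 1) then (sin θ : ℂ) else 0

/-- The projector `|θ⟩⟨θ|`. -/
noncomputable def projTheta (θ : ℝ) : Matrix (Fin 2 × Fin 2) (Fin 2 × Fin 2) ℂ :=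
  Matrix.vecMulVec (ketTheta θ) (star (ketTheta θ))

/-- `σ^θ_{a|x} = tr_A[(M_{a|x} ⊗ 1) |θ⟩⟨θ|]`. -/
noncomputable def sigmaTheta (θ : ℝ) (a x : Fin 2) : Op 2 :=
  ptraceA ((aliceMeas a x ⊗ₖ (1 : Op 2)) * projTheta θ)

theorem aliceMeas_posSemidef (a x : Fin 2) : (aliceMeas a x).PosSemidef := by
  have h : aliceMeas a x = (aliceMeas a x)ᴴ * aliceMeas a x := by
    ext i j
    fin_cases a <;> fin_cases x <;> fin_cases i <;> fin_cases j <;>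
      simp [aliceMeas, pauliZX, Matrix.mul_apply, Fin.sum_univ_two] <;>
      norm_num [show (starRingEnd ℂ) 2 = 2 from Complex.conj_ofNat 2]
  rw [h]
  exact Matrix.posSemidef_conjTranspose_mul_self _

theorem sum_aliceMeas (x : Fin 2) : ∑ a, aliceMeas a x = 1 := by
  ext i j
  fin_cases x <;> fin_cases i <;> fin_cases j <;>
    simp [aliceMeas, pauliZX, Fin.sum_univ_two] <;> norm_num

/-- The assemblage `Σ^{θ,p} = {p σ^θ_{a|x} + (1 - p) 1/4}`. -/
noncomputable def sigmaFamily (θ : ℝ) (p : Set.Icc (0 : ℝ) 1) : Assemblage 2 2 2 where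
  σ a x := ((p : ℝ) : ℂ) • sigmaTheta θ a x + ((1 - (p : ℝ) : ℝ) : ℂ) • ((4⁻¹ : ℂ) • (1 : Op 2))
  realizable := by
    refine ⟨2, ((p : ℝ) : ℂ) • projTheta θ + ((1 - (p : ℝ) : ℝ) : ℂ) • ((4⁻¹ : ℂ) • 1),
      aliceMeas, ?_, ?_, aliceMeas_posSemidef, sum_aliceMeas, fun a x => ?_⟩
    · refine Matrix.PosSemidef.add ?_ ?_
      · exact (Matrix.posSemidef_vecMulVec_self_star _).smul (by exact_mod_cast p.2.1)
      · refine Matrix.PosSemidef.smul (Matrix.PosSemidef.smul Matrix.PosSemidef.one ?_) ?_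
        · rw [show (4⁻¹ : ℂ) = ((4⁻¹ : ℝ) : ℂ) by norm_num]
          exact_mod_cast (by norm_num : (0 : ℝ) ≤ 4⁻¹)
        · exact_mod_cast sub_nonneg.mpr p.2.2
    · have h : (projTheta θ).trace = 1 := by
        simp [Matrix.trace, projTheta, Matrix.vecMulVec_apply, Fintype.sum_prod_type,
          Fin.sum_univ_two, ketTheta, Complex.conj_ofReal, -Complex.ofReal_cos,
          -Complex.ofReal_sin]
        exact_mod_cast (by nlinarith [Real.cos_sq_add_sin_sq θ] :
          cos θ * cos θ + sin θ * sin θ = 1)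
      simp [Matrix.trace_add, h]
    · have h1 : (aliceMeas a x).trace = 1 := by
        fin_cases a <;> fin_cases x <;>
          simp [aliceMeas, pauliZX, Matrix.trace, Fin.sum_univ_two] <;> norm_num
      have h2 : ptraceA (aliceMeas a x ⊗ₖ (1 : Op 2)) = 1 := by
        ext i j
        calc _ = ∑ k, aliceMeas a x k k * (1 : Op 2) i j := rfl
          _ = (aliceMeas a x).trace * (1 : Op 2) i j := (Finset.sum_mul ..).symm
          _ = _ := by rw [h1, one_mul]
      have hadd : ∀ (c c' : ℂ) (ρ τ : Matrix (Fin 2 × Fin 2) (Fin 2 × Fin 2) ℂ),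
          ptraceA (c • ρ + c' • τ) = c • ptraceA ρ + c' • ptraceA τ := by
        intro c c' ρ τ
        ext i j
        simp [ptraceA, Fin.sum_univ_two]
        ring
      simp only [smul_smul, Matrix.mul_add, Matrix.mul_smul, Matrix.mul_one, hadd]
      rw [h2]
      rfl

/-- `Σ^{θ,p}` as a resource. -/
noncomputable def sigmaResource (θ : ℝ) (p : Set.Icc (0 : ℝ) 1) : Resource where
  nA := 2
  nX := 2
  d := 2
  nX_pos := two_pos
  asm := sigmaFamily θ p

/-! ### The two explicit S-1W-LOCC operations -/

/-- The Kraus operators `M_0 = cos θ |0⟩⟨0| + sin θ |1⟩⟨1|` and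
`M_1 = sin θ |1⟩⟨0| + cos θ |0⟩⟨1|`. -/
noncomputable def krausM (θ : ℝ) (w : Fin 2) : Op 2 :=
  if w = 0 then !![(cos θ : ℂ), 0; 0, (sin θ : ℂ)] else !![0, (cos θ : ℂ); (sin θ : ℂ), 0]

theorem trace_krausM (θ : ℝ) (ρ : Op 2) :
    (krausMap (krausM θ 0) ρ).trace + (krausMap (krausM θ 1) ρ).trace = ρ.trace := by
  have h : (cos θ : ℂ) * cos θ + sin θ * sin θ = 1 := by
    exact_mod_cast (by nlinarith [Real.cos_sq_add_sin_sq θ] :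
      cos θ * cos θ + sin θ * sin θ = 1)
  simp only [krausMap, krausM, Matrix.trace, Matrix.diag, LinearMap.coe_mk, AddHom.coe_mk,
    Matrix.mul_apply, Fin.sum_univ_two, Matrix.conjTranspose_apply]
  simp [-Complex.ofReal_cos, -Complex.ofReal_sin]
  linear_combination (ρ 0 0 + ρ 1 1) * h

/-- The instrument with the single map `M_0 · M_0†`; Alice does nothing (`x = x'`, `a' = a`). -/
noncomputable def stochasticOp (θ : ℝ) : OneWayLOCC 2 2 2 2 2 2 where
  W := Unit
  bob _ := krausMap (krausM θ 0)
  bob_cp _ := isCompletelyPositive_krausMap _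
  bob_tni ρ hρ := by
    have h := congrArg Complex.re (trace_krausM θ ρ)
    have h1 := (Complex.nonneg_iff.mp
      ((isCompletelyPositive_krausMap (krausM θ 1)).posSemidef hρ).trace_nonneg).1
    simp only [Complex.add_re] at h
    simp only [Finset.univ_unique, Finset.sum_singleton]
    linarith
  alice _ := Comb.ofFun id fun a _ => a

/-- The instrument with the two maps `M_w · M_w†`, `w = 0, 1`; Alice uses the input `x = x'` and
outputs `a' = a ⊕ xw ⊕ w`, i.e. flips her outcome iff `x = 0` and `w = 1`. -/
noncomputable def deterministicOp (θ : ℝ) : OneWayLOCC 2 2 2 2 2 2 where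
  W := Fin 2
  bob w := krausMap (krausM θ w)
  bob_cp _ := isCompletelyPositive_krausMap _
  bob_tni ρ _ := by rw [Fin.sum_univ_two, trace_krausM]
  alice w := Comb.ofFun id fun a x => a + x * w + w

/-! ### The elements of `Σ^{θ,1}` -/

/-! Every element of `Σ^{θ,1}` is a multiple of a pure state: a computational basis state for
setting 0, and `cos θ |0⟩ ± sin θ |1⟩` for setting 1. Purity makes LOSR conversions rigid. A pure
target cannot be a nontrivial mixture, so each branch occurring with positive probability must map
some source element onto a multiple of the target element. Positivity forces this
(`eq_trace_smul_steeredState`, `LOSROp.orth_of_apply`). Since Bob's map preserves the trace, the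
multiple is the source probability.

Fixing one value of the shared variable thus yields one linear map carrying steered states to
steered states under a relabelling of settings and outcomes (`exists_channel_of_losrConvertible`).
Applied to Bob's reduced state, which is the same for both settings, it forces the outcome
probabilities to match, and hence the angles to coincide (`eq_of_losrConvertible`).

With communication, trace preservation is only required of the sum over Bob's outcomes, so a single
branch may reweight the elements. With `D = diag(cos θ, sin θ)`, the elements of `Σ^{θ,1}` are `D M
D` for Alice's projectors `M`, and those of `Σ^{π/4,1}` are `M/2`. The filter `M_0 = D` therefore
produces `Σ^{θ,1}` with probability 1/2. The other Kraus operator `M_1` is `D` preceded by a bit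
flip, which Alice undoes by relabelling. White noise is then added by discarding everything with
probability `1 - p`. -/

/-- The trace of `σ^θ_{a|x}`. -/
noncomputable def steeredProb (θ : ℝ) (a x : Fin 2) : ℝ :=
  if x = 0 then (if a = 0 then cos θ ^ 2 else sin θ ^ 2) else 1 / 2

/-- The normalised pure state to which `σ^θ_{a|x}` is proportional. -/
noncomputable def steeredState (θ : ℝ) (a x : Fin 2) : Op 2 :=
  if x = 0 then (if a = 0 then !![1, 0; 0, 0] else !![0, 0; 0, 1])
  else !![(cos θ : ℂ) ^ 2, (-1) ^ (a : ℕ) * (cos θ * sin θ);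
    (-1) ^ (a : ℕ) * (cos θ * sin θ), (sin θ : ℂ) ^ 2]

/-- A vector orthogonal to the range of `σ^θ_{a|x}`. -/
noncomputable def orthVec (θ : ℝ) (a x : Fin 2) : Fin 2 → ℂ :=
  if x = 0 then (if a = 0 then ![0, 1] else ![1, 0])
  else ![(sin θ : ℂ), -((-1) ^ (a : ℕ) * cos θ)]

theorem ofReal_cos_sq_add_sin_sq (θ : ℝ) : (cos θ : ℂ) ^ 2 + (sin θ : ℂ) ^ 2 = 1 := by
  exact_mod_cast Real.cos_sq_add_sin_sq θ

theorem sigmaTheta_eq (θ : ℝ) (a x : Fin 2) :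
    sigmaTheta θ a x = (steeredProb θ a x : ℂ) • steeredState θ a x := by
  ext i j
  fin_cases a <;> fin_cases x <;> fin_cases i <;> fin_cases j <;>
    simp [sigmaTheta, steeredProb, steeredState, ptraceA, aliceMeas, pauliZX, projTheta, ketTheta,
      Matrix.mul_apply, Fintype.sum_prod_type, Fin.sum_univ_two, Matrix.vecMulVec_apply,
      Matrix.one_apply, Complex.conj_ofReal, -Complex.ofReal_cos, -Complex.ofReal_sin] <;>
    ring

theorem trace_steeredState (θ : ℝ) (a x : Fin 2) : (steeredState θ a x).trace = 1 := by
  have h := ofReal_cos_sq_add_sin_sq θ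
  fin_cases a <;> fin_cases x <;>
    simp [steeredState, Matrix.trace, Fin.sum_univ_two, -Complex.ofReal_cos,
      -Complex.ofReal_sin, h]

theorem trace_sigmaTheta (θ : ℝ) (a x : Fin 2) :
    (sigmaTheta θ a x).trace = steeredProb θ a x := by
  rw [sigmaTheta_eq, Matrix.trace_smul, trace_steeredState, smul_eq_mul, mul_one]

theorem sigmaFamily_one_σ (θ : ℝ) : (sigmaFamily θ 1).σ = sigmaTheta θ := by
  funext a x
  simp [sigmaFamily]

/-- With `D = diag(cos θ, sin θ)` and `M` Alice's real symmetric projector, the element is `D M D =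
(M D)ᴴ (M D)`. -/
theorem sigmaTheta_posSemidef (θ : ℝ) (a x : Fin 2) : (sigmaTheta θ a x).PosSemidef := by
  have h : sigmaTheta θ a x = (aliceMeas a x * !![(cos θ : ℂ), 0; 0, (sin θ : ℂ)])ᴴ *
      (aliceMeas a x * !![(cos θ : ℂ), 0; 0, (sin θ : ℂ)]) := by
    rw [sigmaTheta_eq]
    ext i j
    fin_cases a <;> fin_cases x <;> fin_cases i <;> fin_cases j <;>
      simp [steeredProb, steeredState, aliceMeas, pauliZX, Matrix.mul_apply, Fin.sum_univ_two,
        Complex.conj_ofReal, -Complex.ofReal_cos, -Complex.ofReal_sin,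
        show (starRingEnd ℂ) 2 = 2 from Complex.conj_ofNat 2] <;>
      ring
  rw [h]
  exact Matrix.posSemidef_conjTranspose_mul_self _

/-- Both sums are Bob's reduced state `diag(cos² θ, sin² θ)`. This relation between the two settings
is what drives the rigidity argument. -/
theorem sigmaTheta_no_signalling (θ : ℝ) :
    sigmaTheta θ 0 0 + sigmaTheta θ 1 0 = sigmaTheta θ 0 1 + sigmaTheta θ 1 1 := by
  simp only [sigmaTheta_eq]
  ext i j
  fin_cases i <;> fin_cases j <;>
    simp [steeredProb, steeredState, -Complex.ofReal_cos, -Complex.ofReal_sin] <;> ring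

theorem orthVec_sigmaTheta (θ : ℝ) (a x : Fin 2) :
    star (orthVec θ a x) ⬝ᵥ sigmaTheta θ a x *ᵥ orthVec θ a x = 0 := by
  rw [sigmaTheta_eq]
  fin_cases a <;> fin_cases x <;>
    simp [steeredProb, steeredState, orthVec, Matrix.mulVec, dotProduct, Fin.sum_univ_two,
      Complex.conj_ofReal, -Complex.ofReal_cos, -Complex.ofReal_sin] <;>
    ring

/-- A positive operator that annihilates the vector orthogonal to a steered state is
proportional to that state. -/
theorem eq_trace_smul_steeredState {θ : ℝ} {a x : Fin 2} {T : Op 2} (hT : T.PosSemidef)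
    (h : star (orthVec θ a x) ⬝ᵥ T *ᵥ orthVec θ a x = 0) :
    T = T.trace • steeredState θ a x := by
  have hr := (hT.dotProduct_mulVec_zero_iff _).mp h
  -- Hermiticity turns the kernel vector into a left kernel vector. In dimension two this leaves
  -- only multiples of the projector onto its orthogonal complement.
  have hl : star (orthVec θ a x) ᵥ* T = 0 := by
    have := congrArg star hr
    rwa [Matrix.star_mulVec, hT.1.eq, star_zero] at this
  have r0 := congrFun hr 0
  have r1 := congrFun hr 1
  have l0 := congrFun hl 0
  have l1 := congrFun hl 1
  have hcs := ofReal_cos_sq_add_sin_sq θ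
  simp only [Matrix.mulVec, Matrix.vecMul, dotProduct, Fin.sum_univ_two] at r0 r1 l0 l1
  fin_cases x
  · fin_cases a <;> simp [orthVec] at r0 r1 l0 l1 <;> ext i j <;>
      fin_cases i <;> fin_cases j <;>
      simp [steeredState, Matrix.trace, Fin.sum_univ_two, r0, r1, l0, l1]
  · simp [orthVec, Complex.conj_ofReal, -Complex.ofReal_cos, -Complex.ofReal_sin] at r0 r1 l0 l1
    have he : ((-1 : ℂ) ^ (a : ℕ)) ^ 2 = 1 := by fin_cases a <;> simp
    have hst : steeredState θ a 1 = !![(cos θ : ℂ) ^ 2, (-1) ^ (a : ℕ) * (cos θ * sin θ);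
      (-1) ^ (a : ℕ) * (cos θ * sin θ), (sin θ : ℂ) ^ 2] := by simp [steeredState]
    -- Only `e² = 1` and `c² + s² = 1` matter from here on.
    generalize (-1 : ℂ) ^ (a : ℕ) = e at *
    generalize (cos θ : ℂ) = c at *
    generalize (sin θ : ℂ) = s at *
    have hE : steeredState θ a 1 = !![c ^ 2, e * (c * s); e * (c * s), s ^ 2] := hst
    change T = T.trace • steeredState θ a 1
    rw [hE]
    ext i j
    fin_cases i <;> fin_cases j <;> simp [Matrix.trace, Fin.sum_univ_two]
    · linear_combination s * r0 + e * c * l1 + c ^ 2 * T 1 1 * he - T 0 0 * hcs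
    · linear_combination -T 0 1 * hcs - c ^ 2 * T 0 1 * he + s * l1 - e * c * r0
    · linear_combination -T 1 0 * hcs - c ^ 2 * T 1 0 * he + s * r1 - e * c * l0
    · linear_combination -s * r0 - e * c * l1 - c ^ 2 * T 1 1 * he - T 1 1 * hcs

/-! ### LOSR conversions -/

/-- The quantifier order is the point: since the marginal of `x` does not depend on `a`, a single
setting of positive weight serves all outcomes `a` at once. -/
theorem comb_exists_of_prob_pos {nA nX nA' nX' : ℕ} (C : Comb nA nX nA' nX') (x' : Fin nX') :
    ∃ x, ∀ a, ∃ a', 0 < C.prob a' x x' a := by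
  obtain ⟨x, -, hx⟩ : ∃ x ∈ Finset.univ, 0 < C.inp x x' :=
    Finset.exists_lt_of_sum_lt (s := Finset.univ) (f := fun _ => (0 : ℝ))
      (g := fun x => C.inp x x') (by simp [C.sum_inp])
  refine ⟨x, fun a => ?_⟩
  obtain ⟨a', -, ha'⟩ : ∃ a' ∈ Finset.univ, 0 < C.prob a' x x' a :=
    Finset.exists_lt_of_sum_lt (s := Finset.univ) (f := fun _ => (0 : ℝ))
      (g := fun a' => C.prob a' x x' a) (by simpa [C.no_retro] using hx)
  exact ⟨a', ha'⟩

/-- A vector annihilated by an element of the result of an LOSR operation is annihilated by every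
contribution to it that occurs with positive probability. -/
theorem LOSROp.orth_of_apply {nA nX d nA' nX' d' : ℕ} (T : LOSROp nA nX d nA' nX' d')
    {σ : Fin nA → Fin nX → Op d} (hσ : ∀ a x, (σ a x).PosSemidef) {a' : Fin nA'} {x' : Fin nX'}
    {v : Fin d' → ℂ} (hv : star v ⬝ᵥ T.apply σ a' x' *ᵥ v = 0) {l : T.L} (hl : 0 < T.p l)
    {a : Fin nA} {x : Fin nX} (hp : 0 < (T.alice l).prob a' x x' a) :
    star v ⬝ᵥ T.bob l (σ a x) *ᵥ v = 0 := by
  -- The vanishing expectation is a sum of nonnegative terms, so it vanishes termwise; the sums over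
  -- `l`, `a` and `x` are peeled off in turn.
  have hq : ∀ l a x, 0 ≤ star v ⬝ᵥ T.bob l (σ a x) *ᵥ v := fun l a x =>
    ((T.bob_cp l).posSemidef (hσ a x)).dotProduct_mulVec_nonneg v
  have hpr : ∀ l a x, 0 ≤ (((T.alice l).prob a' x x' a : ℝ) : ℂ) *
      (star v ⬝ᵥ T.bob l (σ a x) *ᵥ v) :=
    fun l a x => mul_nonneg (by exact_mod_cast (T.alice l).nonneg ..) (hq l a x)
  simp only [LOSROp.apply, branch, Matrix.sum_mulVec, Matrix.smul_mulVec, dotProduct_sum,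
    dotProduct_smul, smul_eq_mul] at hv
  have h1 := (Finset.sum_eq_zero_iff_of_nonneg fun l _ => mul_nonneg
    (by exact_mod_cast T.p_nonneg l) (Finset.sum_nonneg fun a _ => Finset.sum_nonneg fun x _ =>
      hpr l a x)).mp hv l (Finset.mem_univ _)
  have h2 := (mul_eq_zero.mp h1).resolve_left (by exact_mod_cast hl.ne')
  have h3 := (Finset.sum_eq_zero_iff_of_nonneg fun a _ => Finset.sum_nonneg fun x _ =>
    hpr l a x).mp h2 a (Finset.mem_univ _)
  have h4 := (Finset.sum_eq_zero_iff_of_nonneg fun x _ => hpr l a x).mp h3 x (Finset.mem_univ _)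
  exact (mul_eq_zero.mp h4).resolve_left (by exact_mod_cast hp.ne')

/-- An LOSR conversion between members of the family contains a trace-preserving positive map
which permutes settings and outcomes of the steered states. -/
theorem exists_channel_of_losrConvertible {θ₁ θ₂ : ℝ}
    (h : LOSRConvertible (sigmaResource θ₁ 1) (sigmaResource θ₂ 1)) :
    ∃ (Φ : Op 2 →ₗ[ℂ] Op 2) (g : Fin 2 → Fin 2) (f : Fin 2 → Fin 2 → Fin 2), ∀ a x',
      Φ (sigmaTheta θ₁ a (g x')) =
        (steeredProb θ₁ a (g x') : ℂ) • steeredState θ₂ (f x' a) x' := by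
  obtain ⟨T, hT⟩ : ∃ T : LOSROp 2 2 2 2 2 2, ∀ a' x',
      T.apply (sigmaFamily θ₁ 1).σ a' x' = (sigmaFamily θ₂ 1).σ a' x' := h
  simp only [sigmaFamily_one_σ] at hT
  obtain ⟨l, -, hl⟩ : ∃ l ∈ Finset.univ, 0 < T.p l :=
    Finset.exists_lt_of_sum_lt (s := Finset.univ) (f := fun _ => (0 : ℝ))
      (g := T.p) (by simp [T.sum_p])
  choose g f hf using comb_exists_of_prob_pos (T.alice l)
  refine ⟨T.bob l, g, f, fun a x' => ?_⟩
  have hpos := (T.bob_cp l).posSemidef (sigmaTheta_posSemidef θ₁ a (g x'))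
  have horth := T.orth_of_apply (sigmaTheta_posSemidef θ₁)
    (by rw [hT]; exact orthVec_sigmaTheta θ₂ (f x' a) x') hl (hf x' a)
  -- Trace preservation by each individual `bob l` fixes the factor; a single branch of an
  -- instrument need not satisfy this.
  rw [eq_trace_smul_steeredState hpos horth, T.bob_tp l, trace_sigmaTheta]

/-! ### Rigidity: the angle is an LOSR invariant of the family -/

theorem eq_of_cos_sq_eq {θ₁ θ₂ : ℝ} (h₁ : θ₁ ∈ Set.Ioc (0 : ℝ) (Real.pi / 4))
    (h₂ : θ₂ ∈ Set.Ioc (0 : ℝ) (Real.pi / 4)) (h : cos θ₁ ^ 2 = cos θ₂ ^ 2) : θ₁ = θ₂ := by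
  have hpi := Real.pi_pos
  have p₁ := Real.cos_nonneg_of_mem_Icc (x := θ₁) ⟨by linarith [h₁.1], by linarith [h₁.2]⟩
  have p₂ := Real.cos_nonneg_of_mem_Icc (x := θ₂) ⟨by linarith [h₂.1], by linarith [h₂.2]⟩
  exact Real.injOn_cos ⟨h₁.1.le, by linarith [h₁.2]⟩ ⟨h₂.1.le, by linarith [h₂.2]⟩
    ((sq_eq_sq₀ p₁ p₂).mp h)

theorem sin_sq_le_cos_sq {θ : ℝ} (h : θ ∈ Set.Ioc (0 : ℝ) (Real.pi / 4)) :
    sin θ ^ 2 ≤ cos θ ^ 2 := by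
  have hc : 0 ≤ cos (2 * θ) :=
    Real.cos_nonneg_of_mem_Icc ⟨by linarith [h.1, Real.pi_pos], by linarith [h.2]⟩
  rw [Real.cos_two_mul'] at hc
  linarith

theorem sin_pos_and_cos_pos {θ : ℝ} (h : θ ∈ Set.Ioc (0 : ℝ) (Real.pi / 4)) :
    0 < sin θ ∧ 0 < cos θ :=
  ⟨Real.sin_pos_of_pos_of_lt_pi h.1 (by linarith [h.2, Real.pi_pos]),
    Real.cos_pos_of_mem_Ioo ⟨by linarith [h.1, Real.pi_pos], by linarith [h.2, Real.pi_pos]⟩⟩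

theorem steeredProb_pos {θ : ℝ} (h : θ ∈ Set.Ioc (0 : ℝ) (Real.pi / 4)) (a x : Fin 2) :
    0 < steeredProb θ a x := by
  obtain ⟨hs, hc⟩ := sin_pos_and_cos_pos h
  unfold steeredProb
  split_ifs <;> positivity

theorem steeredProb_add (θ : ℝ) (x : Fin 2) : steeredProb θ 0 x + steeredProb θ 1 x = 1 := by
  fin_cases x <;> simp [steeredProb]
  norm_num

theorem eq_of_losrConvertible {θ₁ θ₂ : ℝ} (h₁ : θ₁ ∈ Set.Ioc (0 : ℝ) (Real.pi / 4))
    (h₂ : θ₂ ∈ Set.Ioc (0 : ℝ) (Real.pi / 4))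
    (h : LOSRConvertible (sigmaResource θ₁ 1) (sigmaResource θ₂ 1)) : θ₁ = θ₂ := by
  obtain ⟨Φ, g, f, hΦ⟩ := exists_channel_of_losrConvertible h
  obtain ⟨hs, hc⟩ := sin_pos_and_cos_pos h₂
  have hsC : (sin θ₂ : ℂ) ≠ 0 := Complex.ofReal_ne_zero.mpr hs.ne'
  have hcC : (cos θ₂ : ℂ) ≠ 0 := Complex.ofReal_ne_zero.mpr hc.ne'
  have hns : ∀ x, Φ (sigmaTheta θ₁ 0 x) + Φ (sigmaTheta θ₁ 1 x) =
      Φ (sigmaTheta θ₁ 0 0) + Φ (sigmaTheta θ₁ 1 0) := by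
    intro x
    fin_cases x
    · rfl
    · rw [← map_add, ← map_add, sigmaTheta_no_signalling]
      rfl
  have hoff0 : ∀ a, steeredState θ₂ a 0 0 1 = 0 := by intro a; fin_cases a <;> simp [steeredState]
  have hoff1 : ∀ a : Fin 2, steeredState θ₂ a 1 0 1 = (-1) ^ (a : ℕ) * (cos θ₂ * sin θ₂) := by
    intro a; simp [steeredState]
  -- Otherwise one image would be a nonzero multiple of both a diagonal state and a state with
  -- nonzero off-diagonal entry.
  have hg : g 0 ≠ g 1 := by
    intro hg
    have h0 := hΦ 0 0
    rw [hg, hΦ 0 1] at h0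
    have h01 := congrFun (congrFun h0 0) 1
    simp only [Matrix.smul_apply, hoff0, hoff1, smul_eq_mul, mul_zero] at h01
    have hp := Complex.ofReal_ne_zero.mpr (steeredProb_pos h₁ 0 (g 1)).ne'
    exact mul_ne_zero hp (mul_ne_zero (pow_ne_zero _ (by norm_num)) (mul_ne_zero hcC hsC)) h01
  -- The image of Bob's reduced state, decomposed along the two settings used.
  have hR := (hns (g 0)).trans (hns (g 1)).symm
  rw [hΦ, hΦ, hΦ, hΦ] at hR
  have p0 := steeredProb_pos h₁ 0 (g 1)
  have p1 := steeredProb_pos h₁ 1 (g 1)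
  have hsum := steeredProb_add θ₁ (g 1)
  have hsum' := steeredProb_add θ₁ (g 0)
  have e01 := congrFun (congrFun hR 0) 1
  have e00 := congrFun (congrFun hR 0) 0
  simp only [Matrix.add_apply, Matrix.smul_apply, hoff0, hoff1, smul_eq_mul, mul_zero,
    add_zero] at e01
  have hcs := mul_pos hc hs
  have hcs1 := Real.cos_sq_add_sin_sq θ₂
  have hcs0 := Real.cos_sq_add_sin_sq θ₁
  have hle1 := sin_sq_le_cos_sq h₁
  have hle2 := sin_sq_le_cos_sq h₂
  apply eq_of_cos_sq_eq h₁ h₂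
  -- The off-diagonal entry of the setting-0 decomposition is zero, so the two signed contributions
  -- of setting 1 cancel: the signs are opposite and the weights equal.
  have hhalf : steeredProb θ₁ 0 (g 1) = 1 / 2 ∧ steeredProb θ₁ 1 (g 1) = 1 / 2 := by
    have e : (steeredProb θ₁ 0 (g 1) * (-1) ^ (f 1 0 : ℕ) +
        steeredProb θ₁ 1 (g 1) * (-1) ^ (f 1 1 : ℕ)) * (cos θ₂ * sin θ₂) = 0 := by
      have : ((steeredProb θ₁ 0 (g 1) : ℂ) * (-1) ^ (f 1 0 : ℕ) +
        steeredProb θ₁ 1 (g 1) * (-1) ^ (f 1 1 : ℕ)) * (cos θ₂ * sin θ₂) = 0 := by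
        linear_combination -e01
      exact_mod_cast this
    have e' := (mul_eq_zero.mp e).resolve_right hcs.ne'
    generalize f 1 0 = b0 at *
    generalize f 1 1 = b1 at *
    fin_cases b0 <;> fin_cases b1 <;> simp at e' <;> constructor <;> linarith
  have hdiag : (steeredProb θ₁ 0 (g 0) * (if f 0 0 = 0 then 1 else 0) +
      steeredProb θ₁ 1 (g 0) * (if f 0 1 = 0 then 1 else 0) : ℝ) = cos θ₂ ^ 2 := by
    have d0 : ∀ a : Fin 2, steeredState θ₂ a 0 0 0 = ((if a = 0 then 1 else 0 : ℝ) : ℂ) := by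
      intro a; fin_cases a <;> simp [steeredState]
    have d1 : ∀ a : Fin 2, steeredState θ₂ a 1 0 0 = (cos θ₂ : ℂ) ^ 2 := by
      intro a; simp [steeredState]
    simp only [Matrix.add_apply, Matrix.smul_apply, d0, d1, smul_eq_mul, hhalf.1, hhalf.2] at e00
    have e : (steeredProb θ₁ 0 (g 0) * (if f 0 0 = 0 then 1 else 0) +
      steeredProb θ₁ 1 (g 0) * (if f 0 1 = 0 then 1 else 0) : ℝ) =
        (1 / 2 : ℝ) * cos θ₂ ^ 2 + (1 / 2 : ℝ) * cos θ₂ ^ 2 := by exact_mod_cast e00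
    linarith
  -- As `cos² θ₂` lies strictly between 0 and 1, exactly one of the two outcomes is sent to
  -- `|0⟩⟨0|`.
  have hor : steeredProb θ₁ 0 (g 0) = cos θ₂ ^ 2 ∨ steeredProb θ₁ 1 (g 0) = cos θ₂ ^ 2 := by
    have := pow_pos hc 2
    have := pow_pos hs 2
    split_ifs at hdiag <;> first | (left; linarith) | (right; linarith)
  generalize g 0 = x0 at *
  generalize g 1 = x1 at *
  -- If the settings are kept, either `cos² θ₁ = cos² θ₂`, or `sin² θ₁ = cos² θ₂`; the latter makes
  -- all squares 1/2 because `sin² ≤ cos²` for both angles. If they are swapped, `hhalf` and `hor`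
  -- make both squared cosines 1/2.
  fin_cases x0 <;> fin_cases x1 <;> simp [steeredProb] at hg hhalf hor <;>
    first | linarith | (rcases hor with hor | hor <;> linarith)

/-! ### One-way LOCC conversions -/

theorem branch_ofFun {nA nX d nA' nX' d' : ℕ} (g : Fin nX' → Fin nX)
    (f : Fin nA → Fin nX' → Fin nA') (Φ : Op d →ₗ[ℂ] Op d') (σ : Fin nA → Fin nX → Op d)
    (a' : Fin nA') (x' : Fin nX') :
    branch (Comb.ofFun g f) Φ σ a' x' = ∑ a, if a' = f a x' then Φ (σ a (g x')) else 0 := by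
  simp only [branch, Comb.ofFun]
  refine Finset.sum_congr rfl fun a _ => ?_
  split_ifs with h
  · rw [Finset.sum_eq_single (g x') (by intro x _ hx; simp [hx]) (by simp)]
    simp
  · simp

theorem cos_sin_pi_div_four_sq :
    (cos (Real.pi / 4) : ℂ) ^ 2 = 1 / 2 ∧ (sin (Real.pi / 4) : ℂ) ^ 2 = 1 / 2 ∧
      (cos (Real.pi / 4) : ℂ) * (sin (Real.pi / 4) : ℂ) = 1 / 2 := by
  have h : (√2 / 2) ^ 2 = 1 / 2 := by
    rw [div_pow, Real.sq_sqrt (by norm_num)]; norm_num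
  rw [Real.cos_pi_div_four, Real.sin_pi_div_four]
  have h' := congrArg Complex.ofReal h
  push_cast at h' ⊢
  exact ⟨h', h', by rw [← sq, h']⟩

theorem krausMap_krausM_zero (θ : ℝ) (a x : Fin 2) :
    krausMap (krausM θ 0) (sigmaTheta (Real.pi / 4) a x) = (1 / 2 : ℂ) • sigmaTheta θ a x := by
  obtain ⟨h1, h2, h3⟩ := cos_sin_pi_div_four_sq
  simp only [sigmaTheta_eq]
  ext i j
  simp only [krausMap, LinearMap.coe_mk, AddHom.coe_mk, Matrix.mul_apply, Fin.sum_univ_two,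
    Matrix.conjTranspose_apply, Matrix.smul_apply]
  fin_cases a <;> fin_cases x <;> fin_cases i <;> fin_cases j <;>
    simp [krausM, steeredProb, steeredState, Complex.conj_ofReal, -Complex.ofReal_cos, -Complex.ofReal_sin,
      -Real.cos_pi_div_four, -Real.sin_pi_div_four, h1, h2, h3] <;>
    ring

/-- `M_1` is `diag(cos θ, sin θ)` times a bit flip, and conjugation by the bit flip exchanges the
`σ_z` projectors while fixing the `σ_x` ones; hence the label `a + x + 1`. -/
theorem krausMap_krausM_one (θ : ℝ) (a x : Fin 2) :
    krausMap (krausM θ 1) (sigmaTheta (Real.pi / 4) a x) =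
      (1 / 2 : ℂ) • sigmaTheta θ (a + x + 1) x := by
  obtain ⟨h1, h2, h3⟩ := cos_sin_pi_div_four_sq
  simp only [sigmaTheta_eq]
  ext i j
  simp only [krausMap, LinearMap.coe_mk, AddHom.coe_mk, Matrix.mul_apply, Fin.sum_univ_two,
    Matrix.conjTranspose_apply, Matrix.smul_apply]
  fin_cases a <;> fin_cases x <;> fin_cases i <;> fin_cases j <;>
    simp [krausM, steeredProb, steeredState, Complex.conj_ofReal, -Complex.ofReal_cos, -Complex.ofReal_sin,
      -Real.cos_pi_div_four, -Real.sin_pi_div_four, h1, h2, h3] <;>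
    ring

theorem stochasticOp_converts (θ : ℝ) :
    (stochasticOp θ).Converts (1 / 2) (sigmaFamily (Real.pi / 4) 1) (sigmaFamily θ 1) := by
  refine ⟨by norm_num, fun a' x' => ?_⟩
  simp only [sigmaFamily_one_σ]
  change ∑ _w : Unit, branch (Comb.ofFun id fun a _ => a) (krausMap (krausM θ 0)) _ a' x' = _
  simp [branch_ofFun, krausMap_krausM_zero]

theorem deterministicOp_isDeterministic (θ : ℝ) : (deterministicOp θ).IsDeterministic := by
  intro ρ
  change ∑ w : Fin 2, (krausMap (krausM θ w) ρ).trace = _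
  rw [Fin.sum_univ_two, trace_krausM]

theorem deterministicOp_converts (θ : ℝ) :
    (deterministicOp θ).Converts 1 (sigmaFamily (Real.pi / 4) 1) (sigmaFamily θ 1) := by
  refine ⟨one_pos, fun a' x' => ?_⟩
  simp only [sigmaFamily_one_σ]
  change ∑ w : Fin 2, branch (Comb.ofFun id fun a x => a + x * w + w) (krausMap (krausM θ w))
    _ a' x' = _
  simp only [branch_ofFun, Fin.sum_univ_two, krausMap_krausM_zero, krausMap_krausM_one, id]
  -- Alice's relabelling undoes the flip, so each of the two branches contributes half of the target
  -- element.
  fin_cases a' <;> fin_cases x' <;> simp [← add_smul] <;> norm_num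

/-! ### Adding white noise -/

/-- The comb that ignores Alice's outcome and outputs a uniformly random one. -/
noncomputable def Comb.uniform (nA nX k : ℕ) : Comb nA nX (k + 1) nX where
  prob _ x x' _ := if x = x' then ((k + 1 : ℕ) : ℝ)⁻¹ else 0
  inp x x' := if x = x' then 1 else 0
  nonneg _ _ _ _ := by split_ifs <;> positivity
  inp_nonneg _ _ := by split_ifs <;> norm_num
  sum_inp _ := by simp
  no_retro x x' _ := by
    split_ifs
    · rw [Finset.sum_const, Finset.card_univ, Fintype.card_fin, nsmul_eq_mul,
        mul_inv_cancel₀ (by positivity)]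
    · simp

/-- The completely depolarising channel on a qubit. -/
noncomputable def depolarize : Op 2 →ₗ[ℂ] Op 2 where
  toFun ρ := (ρ.trace / 2) • (1 : Op 2)
  map_add' ρ τ := by rw [Matrix.trace_add, add_div, add_smul]
  map_smul' c ρ := by simp [smul_smul, mul_div_assoc]

theorem IsCompletelyPositive.add {d e : ℕ} {Φ Ψ : Op d →ₗ[ℂ] Op e}
    (hΦ : IsCompletelyPositive Φ) (hΨ : IsCompletelyPositive Ψ) :
    IsCompletelyPositive (Φ + Ψ) := fun k M hM => (hΦ k M hM).add (hΨ k M hM)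

theorem IsCompletelyPositive.smul {d e : ℕ} {Φ : Op d →ₗ[ℂ] Op e}
    (hΦ : IsCompletelyPositive Φ) {c : ℝ} (hc : 0 ≤ c) :
    IsCompletelyPositive ((c : ℂ) • Φ) := fun k M hM =>
  (hΦ k M hM).smul (a := (c : ℂ)) (by exact_mod_cast hc)

/-- The matrix units satisfy `∑ E_ij ρ E_ij† = tr(ρ) 1`; this Kraus form gives complete positivity.
-/
theorem depolarize_eq : depolarize = ((1 / 2 : ℝ) : ℂ) • (krausMap !![1, 0; 0, 0] +
    krausMap !![0, 1; 0, 0] + krausMap !![0, 0; 1, 0] + krausMap !![0, 0; 0, 1]) := by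
  refine LinearMap.ext fun ρ => ?_
  ext i j
  simp only [depolarize, krausMap, LinearMap.smul_apply, LinearMap.add_apply, LinearMap.coe_mk,
    AddHom.coe_mk, Matrix.smul_apply, Matrix.add_apply, Matrix.mul_apply, Fin.sum_univ_two,
    Matrix.conjTranspose_apply]
  fin_cases i <;> fin_cases j <;> simp [Matrix.trace, Fin.sum_univ_two] <;> ring

theorem isCompletelyPositive_depolarize : IsCompletelyPositive depolarize := by
  rw [depolarize_eq]
  exact ((((isCompletelyPositive_krausMap _).add (isCompletelyPositive_krausMap _)).add
    (isCompletelyPositive_krausMap _)).add (isCompletelyPositive_krausMap _)).smul (by norm_num)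

theorem trace_depolarize (ρ : Op 2) : (depolarize ρ).trace = ρ.trace := by
  simp [depolarize]

theorem mix_trace (p : ℝ) (ρ : Op 2) : ∑ w : Fin 2, ((if w = 0 then (p : ℂ) • LinearMap.id
    else ((1 - p : ℝ) : ℂ) • depolarize : Op 2 →ₗ[ℂ] Op 2) ρ).trace = ρ.trace := by
  simp [Fin.sum_univ_two, trace_depolarize, ← add_mul]

/-- With probability `p` nothing is done; otherwise Bob's state is replaced by the maximally mixed
one and Alice's outcome by a uniformly random one. -/
noncomputable def mixOp (p : Set.Icc (0 : ℝ) 1) : OneWayLOCC 2 2 2 2 2 2 where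
  W := Fin 2
  bob w := if w = 0 then ((p : ℝ) : ℂ) • LinearMap.id else ((1 - (p : ℝ) : ℝ) : ℂ) • depolarize
  bob_cp w := by
    split_ifs
    · exact (isCompletelyPositive_id 2).smul p.2.1
    · exact isCompletelyPositive_depolarize.smul (sub_nonneg.mpr p.2.2)
  bob_tni ρ _ := by rw [mix_trace]
  alice w := if w = 0 then Comb.ofFun id fun a _ => a else Comb.uniform 2 2 1

theorem mixOp_converts (θ : ℝ) (p : Set.Icc (0 : ℝ) 1) :
    (mixOp p).Converts 1 (sigmaFamily θ 1) (sigmaFamily θ p) := by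
  refine ⟨one_pos, fun a' x' => ?_⟩
  have ht : ((steeredProb θ 0 x' : ℝ) : ℂ) + (steeredProb θ 1 x' : ℝ) = 1 := by
    exact_mod_cast steeredProb_add θ x'
  -- Depolarising leaves half of `steeredProb θ a x'` times the identity; these probabilities sum to
  -- 1 over `a`, and the random output contributes another factor 1/2.
  have hb : branch (Comb.uniform 2 2 1) depolarize (sigmaTheta θ) a' x' =
      (4⁻¹ : ℂ) • (1 : Op 2) := by
    simp only [branch, Comb.uniform]
    have : ∀ a, ∑ x, (((if x = x' then ((1 + 1 : ℕ) : ℝ)⁻¹ else 0 : ℝ)) : ℂ) •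
        depolarize (sigmaTheta θ a x) = (steeredProb θ a x' / 4 : ℂ) • (1 : Op 2) := by
      intro a
      rw [Finset.sum_eq_single x' (by intro x _ hx; simp [hx]) (by simp)]
      simp only [depolarize, LinearMap.coe_mk, AddHom.coe_mk, trace_sigmaTheta, smul_smul, if_true]
      congr 1
      push_cast
      ring
    simp only [this, Fin.sum_univ_two, ← add_smul, ← add_div, ht, one_div]
  have hsmul : ∀ (C : Comb 2 2 2 2) (c : ℂ) (Φ : Op 2 →ₗ[ℂ] Op 2),
      branch C (c • Φ) (sigmaTheta θ) a' x' = c • branch C Φ (sigmaTheta θ) a' x' := by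
    intro C c Φ
    simp only [branch, Finset.smul_sum, LinearMap.smul_apply]
    exact Finset.sum_congr rfl fun a _ => Finset.sum_congr rfl fun x _ => smul_comm _ _ _
  rw [sigmaFamily_one_σ]
  change ∑ w : Fin 2, branch (if w = 0 then Comb.ofFun id fun a _ => a else Comb.uniform 2 2 1)
    (if w = 0 then ((p : ℝ) : ℂ) • LinearMap.id else ((1 - (p : ℝ) : ℝ) : ℂ) • depolarize)
    (sigmaTheta θ) a' x' = _
  rw [Fin.sum_univ_two]
  simp only [if_true, one_ne_zero, if_false, hsmul, hb, branch_id, sigmaFamily,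
    Complex.ofReal_one, one_smul]

theorem det1WConvertible_sigmaResource (θ : ℝ) (p : Set.Icc (0 : ℝ) 1) :
    Det1WConvertible (sigmaResource (Real.pi / 4) 1) (sigmaResource θ p) :=
  have h : ((mixOp p).comp (deterministicOp θ)).Converts 1 (sigmaFamily (Real.pi / 4) 1)
      (sigmaFamily θ p) := by
    simpa using (mixOp_converts θ p).comp (deterministicOp_converts θ)
  ⟨(mixOp p).comp (deterministicOp θ),
    OneWayLOCC.IsDeterministic.comp (fun ρ => mix_trace p ρ) (deterministicOp_isDeterministic θ),
    h⟩

theorem Det1WConvertible.s1WConvertible {R S : Resource} (h : Det1WConvertible R S) :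
    S1WConvertible R S :=
  let ⟨T, _, hT⟩ := h
  ⟨T, 1, hT⟩

/-! ### Separation of the pre-orders -/

/-- A concrete witness; any angle strictly between 0 and `π/4` would serve in place of `π/6`. -/
theorem not_losrConvertible_pi_div_six :
    ¬ LOSRConvertible (sigmaResource (Real.pi / 4) 1) (sigmaResource (Real.pi / 6) 1) := by
  intro h
  have hpi := Real.pi_pos
  have := eq_of_losrConvertible ⟨by positivity, le_rfl⟩ ⟨by positivity, by linarith⟩ h
  linarith

theorem proposition1 :
    -- The pre-orders under LOSR and under (stochastic, deterministic) 1W-LOCC are different.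
    losrPreorder ≠ s1wPreorder ∧
    losrPreorder ≠ det1wPreorder ∧
    -- The stochastic Kraus map converts with probability one half.
    (∀ θ ∈ Set.Ioc (0 : ℝ) (Real.pi / 4),
      (stochasticOp θ).Converts (1 / 2) (sigmaFamily (Real.pi / 4) 1) (sigmaFamily θ 1)) ∧
    -- The deterministic 1W-LOCC map.
    (∀ θ ∈ Set.Ioc (0 : ℝ) (Real.pi / 4),
      (deterministicOp θ).IsDeterministic ∧
      (deterministicOp θ).Converts 1 (sigmaFamily (Real.pi / 4) 1) (sigmaFamily θ 1)) ∧
    -- The maximally entangled element is above the whole family.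
    (∀ θ ∈ Set.Ioc (0 : ℝ) (Real.pi / 4), ∀ p : Set.Icc (0 : ℝ) 1,
      S1WConvertible (sigmaResource (Real.pi / 4) 1) (sigmaResource θ p) ∧
      Det1WConvertible (sigmaResource (Real.pi / 4) 1) (sigmaResource θ p)) ∧
    -- Under LOSR the elements with `p = 1` are pairwise incomparable.
    (∀ θ₁ ∈ Set.Ioc (0 : ℝ) (Real.pi / 4), ∀ θ₂ ∈ Set.Ioc (0 : ℝ) (Real.pi / 4), θ₁ ≠ θ₂ →
      ¬ LOSRConvertible (sigmaResource θ₁ 1) (sigmaResource θ₂ 1) ∧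
      ¬ LOSRConvertible (sigmaResource θ₂ 1) (sigmaResource θ₁ 1)) := by
  have hdet := det1WConvertible_sigmaResource (Real.pi / 6) 1
  refine ⟨fun h => ?_, fun h => ?_, fun θ _ => stochasticOp_converts θ,
    fun θ _ => ⟨deterministicOp_isDeterministic θ, deterministicOp_converts θ⟩,
    fun θ _ p => ⟨(det1WConvertible_sigmaResource θ p).s1WConvertible,
      det1WConvertible_sigmaResource θ p⟩,
    fun θ₁ h₁ θ₂ h₂ hne => ⟨fun h => hne (eq_of_losrConvertible h₁ h₂ h),
      fun h => hne (eq_of_losrConvertible h₂ h₁ h).symm⟩⟩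
  -- If the pre-orders were equal, the existing one-way conversion would also be an LOSR conversion.
  · have hle : s1wPreorder.le (sigmaResource (Real.pi / 6) 1) (sigmaResource (Real.pi / 4) 1) :=
      hdet.s1WConvertible
    rw [← h] at hle
    exact not_losrConvertible_pi_div_six hle
  · have hle : det1wPreorder.le (sigmaResource (Real.pi / 6) 1) (sigmaResource (Real.pi / 4) 1) :=
      hdet
    rw [← h] at hle
    exact not_losrConvertible_pi_div_six hle
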